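/- Let $q$ be a prime power and let $k,t\ge 1$ be integers. A matrix $M\in\mathbb F_q^{k\times n}$ *can serve* a list $v_1,\dots,v_t$ of nonzero vectors of $\mathbb F_q^k$ if there are pairwise disjoint sets $X_1,\dots,X_t\subseteq\{1,\dots,n\}$ such that, for every $i$, $v_i$ lies in the $\mathbb F_q$-span of the columns of $M$ indexed by $X_i$. A $k$-dimensional linear code $\mathcal C\subseteq\mathbb F_q^n$ is a *$t$-functional PIR code* if it has a generator matrix $M\in\mathbb F_q^{k\times n}$ (a matrix whose rows form a basis of $\mathcal C$) that can serve, for every nonzero $v\in\mathbb F_q^k$, the list consisting of $t$ copies of $v$; it is a *$t$-functional batch code* if it has a generator matrix that can serve every list of $t$ nonzero vectors of $\mathbb F_q^k$. Let $\mathrm{FP}(k,t,q)$ and $\mathrm{FB}(k,t,q)$ denote the minimum length $n$ of a $k$-dimensional $t$-functional PIR code, respectively $t$-functional batch code, over $\mathbb F_q$. **Proposition.** Let $q$ be a fixed prime power and let $(k_n)_{n\in\mathbb N}$ and $(t_n)_{n\in\mathbb N}$ be sequences of natural numbers with $k_n\to\infty$ and $t_n\to\infty$. Then $$\lim_{n\to\infty}\frac{\mathrm{FP}(k_n,t_n,q)}{k_nt_n}=\lim_{n\to\infty}\frac{\mathrm{FB}(k_n,t_n,q)}{k_nt_n}=0.$$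 -/

import Mathlib

open Filter Topology

/-- `R` is a recovery set for `v`: `v` lies in the span of the columns of `M` indexed by `R`. -/
def IsRecoverySet {F : Type*} [Field F] {k n : ℕ} (M : Matrix (Fin k) (Fin n) F)
    (v : Fin k → F) (R : Set (Fin n)) : Prop :=
  v ∈ Submodule.span F (M.col '' R)

/-- `M` can serve the list `L 0, …, L (t - 1)`: there are pairwise disjoint recovery sets for its
entries. -/
def Serves {F : Type*} [Field F] {k n t : ℕ} (M : Matrix (Fin k) (Fin n) F)
    (L : Fin t → (Fin k → F)) : Prop :=
  ∃ X : Fin t → Set (Fin n),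
    (∀ i j, i ≠ j → Disjoint (X i) (X j)) ∧ ∀ i, IsRecoverySet M (L i) (X i)

/-- `M` is a generator matrix of the linear code `C`: its rows form a basis of `C`. -/
def IsGeneratorMatrix {F : Type*} [Field F] {k n : ℕ} (M : Matrix (Fin k) (Fin n) F)
    (C : Submodule F (Fin n → F)) : Prop :=
  LinearIndependent F M.row ∧ Submodule.span F (Set.range M.row) = C

/-- `C` is a `t`-functional PIR code: some generator matrix of `C` serves, for every nonzero
vector `v`, the list consisting of `t` copies of `v`. -/
def IsFunctionalPIRCode {F : Type*} [Field F] {n : ℕ} (t : ℕ)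
    (C : Submodule F (Fin n → F)) : Prop :=
  ∃ (k : ℕ) (M : Matrix (Fin k) (Fin n) F), IsGeneratorMatrix M C ∧
    ∀ v : Fin k → F, v ≠ 0 → Serves M (fun _ : Fin t => v)

/-- `C` is a `t`-functional batch code: some generator matrix of `C` serves every list of `t`
nonzero vectors. -/
def IsFunctionalBatchCode {F : Type*} [Field F] {n : ℕ} (t : ℕ)
    (C : Submodule F (Fin n → F)) : Prop :=
  ∃ (k : ℕ) (M : Matrix (Fin k) (Fin n) F), IsGeneratorMatrix M C ∧
    ∀ L : Fin t → (Fin k → F), (∀ i, L i ≠ 0) → Serves M L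

/-- The minimum length of a `k`-dimensional `t`-functional PIR code over `F`. -/
noncomputable def FP (F : Type*) [Field F] (k t : ℕ) : ℕ :=
  sInf {n : ℕ | ∃ C : Submodule F (Fin n → F),
    Module.finrank F C = k ∧ IsFunctionalPIRCode t C}

/-- The minimum length of a `k`-dimensional `t`-functional batch code over `F`. -/
noncomputable def FB (F : Type*) [Field F] (k t : ℕ) : ℕ :=
  sInf {n : ℕ | ∃ C : Submodule F (Fin n → F),
    Module.finrank F C = k ∧ IsFunctionalBatchCode t C}

/-- The minimum defining `FB` is over a nonempty set: `t` concatenated identity matrices give a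
`t`-functional batch code. -/
theorem exists_functionalBatchCode (F : Type*) [Field F] (k t : ℕ) (ht : 1 ≤ t) :
    ∃ (n : ℕ) (C : Submodule F (Fin n → F)),
      Module.finrank F C = k ∧ IsFunctionalBatchCode t C := by
  classical
  let M : Matrix (Fin k) (Fin (t * k)) F :=
    fun i j => (Pi.single (finProdFinEquiv.symm j).2 1 : Fin k → F) i
  have hM : ∀ (a : Fin t) (b : Fin k), M.col (finProdFinEquiv (a, b)) = Pi.single b 1 := by
    intro a b
    ext i
    change (Pi.single (finProdFinEquiv.symm (finProdFinEquiv (a, b))).2 1 : Fin k → F) i = _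
    rw [Equiv.symm_apply_apply]
  have hli : LinearIndependent F M.row := by
    rw [Fintype.linearIndependent_iff]
    intro g hg b
    have h := congrFun hg (finProdFinEquiv (⟨0, ht⟩, b))
    have hM' : ∀ i, M i (finProdFinEquiv (⟨0, ht⟩, b)) = (Pi.single b 1 : Fin k → F) i :=
      fun i => congrFun (hM ⟨0, ht⟩ b) i
    simpa [Finset.sum_apply, hM', Pi.single_apply] using h
  refine ⟨t * k, Submodule.span F (Set.range M.row), ?_, k, M, ⟨hli, rfl⟩, ?_⟩
  · simpa using finrank_span_eq_card hli
  · intro L _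
    refine ⟨fun a => Set.range fun b => finProdFinEquiv (a, b), ?_, ?_⟩
    · intro i j hij
      rw [Set.disjoint_left]
      rintro x ⟨b, rfl⟩ ⟨c, hc⟩
      have h := finProdFinEquiv.injective hc
      exact hij (Prod.ext_iff.1 h).1.symm
    · intro a
      unfold IsRecoverySet
      rw [pi_eq_sum_univ' (L a)]
      refine Submodule.sum_mem _ fun b _ => Submodule.smul_mem _ _ (Submodule.subset_span ?_)
      refine ⟨finProdFinEquiv (a, b), ⟨b, rfl⟩, ?_⟩
      rw [hM]

/-- The minimum defining `FP` is over a nonempty set. -/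
theorem exists_functionalPIRCode (F : Type*) [Field F] (k t : ℕ) (ht : 1 ≤ t) :
    ∃ (n : ℕ) (C : Submodule F (Fin n → F)),
      Module.finrank F C = k ∧ IsFunctionalPIRCode t C := by
  obtain ⟨n, C, hC, k', M, hM, h⟩ := exists_functionalBatchCode F k t ht
  exact ⟨n, C, hC, k', M, hM, fun v hv => h _ fun _ => hv⟩

/-!
Both minima are bounded by the length of one explicit construction.

Fix a block length `d` and consider the code whose columns are all `N = q ^ d` vectors of `F ^ d`.
It serves about `N / 4` requests greedily: a request `v` is answered by a pair `{u, v - u}`, and if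
`i` requests have been answered so far, at most `2 * i` vectors are in use, so at most `4 * i`
choices of `u` are excluded (`exists_pairwise_disjoint_pairs`). So in dimension `d` the length per
request is at most the constant `4`, rather than growing with `d`.

For general `k` and `t`, cut the coordinates into `m` blocks of length at most `d`, cut the
requests into `s` groups of size at most `T = ⌈N / 4⌉`, and take a copy of this code for each block
and each group; the parts of a request in the different blocks are recovered separately and added
up (`exists_serving_columns`). The length is `m * s * N`, and for `k ≥ d` and `t ≥ T` it is at most
`16 * k * t / d` (`length_mul_le`). As `d` is arbitrary, the quotient tends to `0`.
-/

/-! ### The greedy choice of recovery pairs -/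

/-- In a finite abelian group `V`, a list of at most `⌈|V| / 4⌉` elements (repetitions allowed) can
be written as sums of pairs of elements such that pairs of different entries are disjoint. A pair
may be degenerate, `u i = L i - u i`. -/
theorem exists_pairwise_disjoint_pairs {V : Type*} [AddCommGroup V] [Fintype V] [DecidableEq V]
    (T : ℕ) (hT : 4 * T < Fintype.card V + 4) (L : Fin T → V) :
    ∃ u : Fin T → V, ∀ i j, i ≠ j →
      Disjoint ({u i, L i - u i} : Finset V) {u j, L j - u j} := by
  induction T with
  | zero => exact ⟨fun i => i.elim0, fun i => i.elim0⟩
  | succ T ih =>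
    obtain ⟨u, hu⟩ := ih (by omega) (fun i => L i.succ)
    set U : Finset V := Finset.univ.biUnion fun i => {u i, L i.succ - u i} with hU
    have hUcard : U.card ≤ T * 2 := by
      simpa using Finset.card_biUnion_le_card_mul Finset.univ
        (fun i => ({u i, L i.succ - u i} : Finset V)) 2 fun i _ => Finset.card_le_two
    obtain ⟨x, hx⟩ : ∃ x, x ∉ U ∪ U.image (fun y => L 0 - y) := by
      by_contra! h
      have h1 := Finset.card_union_le U (U.image fun y => L 0 - y)
      have h2 : (U.image fun y => L 0 - y).card ≤ U.card := Finset.card_image_le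
      rw [Finset.eq_univ_iff_forall.2 h, Finset.card_univ] at h1
      omega
    have hxU : x ∉ U := fun h => hx (Finset.mem_union_left _ h)
    have hxU' : L 0 - x ∉ U := fun h =>
      hx (Finset.mem_union_right _ (Finset.mem_image.2 ⟨_, h, by abel⟩))
    have hdisj : ∀ j, Disjoint ({x, L 0 - x} : Finset V) {u j, L j.succ - u j} := by
      intro j
      rw [Finset.disjoint_left]
      intro y hy hyj
      have hyU : y ∈ U := Finset.mem_biUnion.2 ⟨j, Finset.mem_univ j, hyj⟩
      rcases Finset.mem_insert.1 hy with rfl | hy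
      · exact hxU hyU
      · exact hxU' (Finset.mem_singleton.1 hy ▸ hyU)
    refine ⟨Fin.cons x u, fun i j => ?_⟩
    refine Fin.cases ?_ (fun i => ?_) i <;> refine Fin.cases ?_ (fun j => ?_) j
    · exact fun h => absurd rfl h
    · exact fun _ => by simpa using hdisj j
    · exact fun _ => by simpa using (hdisj i).symm
    · exact fun h => by simpa using hu i j fun e => h (congrArg Fin.succ e)

/-! ### Codes from families of columns -/

/-- A family of columns, indexed by any finite type, that contains the standard basis and serves
every list of length `t` bounds both minimum lengths by its cardinality. -/
theorem FP_le_and_FB_le_card {F : Type*} [Field F] {ι : Type*} [Fintype ι] {k t : ℕ}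
    (c : ι → Fin k → F) (hbasis : ∀ i, ∃ x, c x = Pi.single i 1)
    (hserve : ∀ L : Fin t → Fin k → F, ∃ X : Fin t → Set ι,
      (∀ i j, i ≠ j → Disjoint (X i) (X j)) ∧ ∀ i, L i ∈ Submodule.span F (c '' X i)) :
    FP F k t ≤ Fintype.card ι ∧ FB F k t ≤ Fintype.card ι := by
  classical
  let e := Fintype.equivFin ι
  let M : Matrix (Fin k) (Fin (Fintype.card ι)) F := fun i x => c (e.symm x) i
  have hli : LinearIndependent F M.row := by
    rw [Fintype.linearIndependent_iff]
    intro g hg b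
    obtain ⟨x, hx⟩ := hbasis b
    have h := congrFun hg (e x)
    have hM : ∀ i, M i (e x) = (Pi.single b 1 : Fin k → F) i := fun i => by simp [M, hx]
    simpa [Finset.sum_apply, hM, Pi.single_apply] using h
  have hfin : Module.finrank F (Submodule.span F (Set.range M.row)) = k := by
    simpa using finrank_span_eq_card hli
  have hM : ∀ L : Fin t → Fin k → F, Serves M L := by
    intro L
    obtain ⟨X, hX, hL⟩ := hserve L
    refine ⟨fun i => e '' X i, fun i j hij => (Set.disjoint_image_iff e.injective).2 (hX i j hij),
      fun i => ?_⟩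
    have himage : M.col '' (e '' X i) = c '' X i := by
      rw [Set.image_image]
      refine Set.image_congr fun x _ => ?_
      ext j
      exact congrArg (fun y => c y j) (e.symm_apply_apply x)
    unfold IsRecoverySet
    rw [himage]
    exact hL i
  exact ⟨Nat.sInf_le ⟨_, hfin, k, M, ⟨hli, rfl⟩, fun v _ => hM _⟩,
    Nat.sInf_le ⟨_, hfin, k, M, ⟨hli, rfl⟩, fun L _ => hM L⟩⟩

/-! ### The block construction -/

/-- The column of `F ^ k` that carries the vector `w` in the `a`-th block of `d` consecutive
coordinates and vanishes elsewhere. If the last block sticks out beyond the `k`-th coordinate,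
the superfluous coordinates of `w` are dropped. -/
def blockColumn {F : Type*} [Field F] (k : ℕ) {d : ℕ} (hd : 0 < d) (a : ℕ) (w : Fin d → F) :
    Fin k → F :=
  fun i => if (i : ℕ) / d = a then w ⟨i % d, Nat.mod_lt _ hd⟩ else 0

/-- The `a`-th block of `d` consecutive coordinates of `v`, padded with zeros. -/
def block {F : Type*} [Field F] {k : ℕ} (d : ℕ) (v : Fin k → F) (a : ℕ) : Fin d → F :=
  fun j => if h : d * a + j < k then v ⟨d * a + j, h⟩ else 0

theorem blockColumn_add {F : Type*} [Field F] (k : ℕ) {d : ℕ} (hd : 0 < d) (a : ℕ)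
    (w w' : Fin d → F) :
    blockColumn k hd a (w + w') = blockColumn k hd a w + blockColumn k hd a w' := by
  ext i
  by_cases h : (i : ℕ) / d = a <;> simp [blockColumn, h]

theorem sum_blockColumn_block {F : Type*} [Field F] {k d m : ℕ} (hd : 0 < d) (hm : k ≤ m * d)
    (v : Fin k → F) :
    ∑ a : Fin m, blockColumn k hd a (block d v a) = v := by
  ext i
  have hi : (i : ℕ) / d < m := Nat.div_lt_of_lt_mul (by rw [mul_comm]; omega)
  rw [Finset.sum_apply, Finset.sum_eq_single ⟨(i : ℕ) / d, hi⟩]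
  · simp [blockColumn, block, Nat.div_add_mod]
  · intro a _ ha
    exact if_neg fun h => ha (Fin.ext h.symm)
  · simp

theorem blockColumn_single {F : Type*} [Field F] {k d : ℕ} (hd : 0 < d) (i : Fin k) :
    blockColumn k hd ((i : ℕ) / d) (Pi.single ⟨i % d, Nat.mod_lt _ hd⟩ 1 : Fin d → F) =
      Pi.single i 1 := by
  ext j
  by_cases hij : j = i
  · subst hij
    simp [blockColumn]
  · rw [Pi.single_eq_of_ne hij]
    by_cases h : (j : ℕ) / d = (i : ℕ) / d
    · have hmod : (j : ℕ) % d ≠ (i : ℕ) % d := fun h' => hij <| Fin.ext <| by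
        rw [← Nat.div_add_mod (j : ℕ) d, ← Nat.div_add_mod (i : ℕ) d, h, h']
      simp [blockColumn, h, hmod]
    · simp [blockColumn, h]

/-- One copy of all vectors of `F ^ d` for each of `m` blocks of coordinates and each of `s` groups
of `T` requests serves every list of `t ≤ s * T` vectors of `F ^ k`, `k ≤ m * d`. Zero vectors
need no exception, which matters because a nonzero vector may have zero blocks. -/
theorem exists_serving_columns {F : Type*} [Field F] [Fintype F] {k t d m s T : ℕ} (hd : 0 < d)
    (hT : 0 < T) (hm : k ≤ m * d) (hs : t ≤ s * T)
    (hcard : 4 * T < Fintype.card (Fin d → F) + 4) (L : Fin t → Fin k → F) :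
    ∃ X : Fin t → Set (Fin m × Fin s × (Fin d → F)),
      (∀ i j, i ≠ j → Disjoint (X i) (X j)) ∧
        ∀ i, L i ∈ Submodule.span F ((fun x => blockColumn k hd x.1 x.2.2) '' X i) := by
  classical
  -- The `c`-th request of the `b`-th group, set to zero where the last group is not full.
  let R : ℕ → ℕ → Fin k → F := fun b c => if h : T * b + c < t then L ⟨T * b + c, h⟩ else 0
  have hR : ∀ i : Fin t, R (i / T) (i % T) = L i := fun i => by simp [R, Nat.div_add_mod]
  choose u hu using fun (a b : ℕ) =>
    exists_pairwise_disjoint_pairs T hcard fun c : Fin T => block d (R b c) a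
  let pos : Fin t → Fin T := fun i => ⟨i % T, Nat.mod_lt _ hT⟩
  let P : ℕ → Fin t → Finset (Fin d → F) := fun a i =>
    {u a (i / T) (pos i), block d (L i) a - u a (i / T) (pos i)}
  refine ⟨fun i => {x | (x.2.1 : ℕ) = i / T ∧ x.2.2 ∈ P x.1 i}, fun i j hij => ?_, fun i => ?_⟩
  · rw [Set.disjoint_left]
    rintro ⟨a, b, w⟩ ⟨hi, hwi⟩ ⟨hj, hwj⟩
    have hdiv : (i : ℕ) / T = j / T := hi.symm.trans hj
    have hpos : pos i ≠ pos j := fun h => hij <| Fin.ext <| by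
      rw [← Nat.div_add_mod (i : ℕ) T, ← Nat.div_add_mod (j : ℕ) T, hdiv, Fin.mk.inj h]
    have hdisj := hu a (i / T) (pos i) (pos j) hpos
    refine Finset.disjoint_left.1 hdisj (?_ : w ∈ _) ?_
    · simpa only [pos, hR] using hwi
    · have hRj : R (i / T) (j % T) = L j := hdiv ▸ hR j
      simpa only [P, pos, hRj, ← hdiv] using hwj
  · have hlt : (i : ℕ) / T < s := Nat.div_lt_of_lt_mul (by rw [mul_comm]; omega)
    have hmem : ∀ (a : Fin m) (w : Fin d → F), w ∈ P a i → blockColumn k hd a w ∈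
        Submodule.span F ((fun x : Fin m × Fin s × (Fin d → F) => blockColumn k hd x.1 x.2.2) ''
          {x | (x.2.1 : ℕ) = i / T ∧ x.2.2 ∈ P x.1 i}) := fun a w hw =>
      Submodule.subset_span ⟨(a, ⟨(i : ℕ) / T, hlt⟩, w), ⟨rfl, hw⟩, rfl⟩
    have hsum := sum_blockColumn_block hd hm (L i)
    rw [← hsum]
    refine Submodule.sum_mem _ fun a _ => ?_
    rw [← add_sub_cancel (u a (i / T) (pos i)) (block d (L i) a), blockColumn_add]
    exact Submodule.add_mem _ (hmem a _ (by simp [P])) (hmem a _ (by simp [P]))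

/-! ### The asymptotic estimate -/

theorem length_mul_le {k t d T N : ℕ} (hk : d ≤ k) (ht : T ≤ t) (hN : N ≤ 4 * T) :
    ((k / d + 1) * ((t / T + 1) * N)) * d ≤ 16 * (k * t) := by
  have h1 : (k / d + 1) * d ≤ 2 * k := by
    have := Nat.div_mul_le_self k d
    rw [add_mul]
    omega
  have h2 : (t / T + 1) * T ≤ 2 * t := by
    have := Nat.div_mul_le_self t T
    rw [add_mul]
    omega
  calc ((k / d + 1) * ((t / T + 1) * N)) * d
      ≤ ((k / d + 1) * ((t / T + 1) * (4 * T))) * d := by gcongr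
    _ = 4 * (((k / d + 1) * d) * ((t / T + 1) * T)) := by ring
    _ ≤ 4 * ((2 * k) * (2 * t)) := by gcongr
    _ = 16 * (k * t) := by ring

/-- For every block length `d`, both minimum lengths are at most `16 * k * t / d` once `k ≥ d` and
`t` is large in terms of `d` and the field. -/
theorem exists_FP_FB_mul_le (F : Type*) [Field F] [Finite F] {d : ℕ} (hd : 0 < d) :
    ∃ T : ℕ, ∀ k t : ℕ, d ≤ k → T ≤ t →
      FP F k t * d ≤ 16 * (k * t) ∧ FB F k t * d ≤ 16 * (k * t) := by
  classical
  have := Fintype.ofFinite F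
  set N := Fintype.card (Fin d → F) with hN
  have hNpos : 0 < N := Fintype.card_pos
  -- `⌈N / 4⌉` is the largest number of requests that the greedy choice can serve.
  refine ⟨(N + 3) / 4, fun k t hk ht => ?_⟩
  set T := (N + 3) / 4 with hT
  have hTpos : 0 < T := by omega
  have hm : k < (k / d + 1) * d := by rw [mul_comm]; exact Nat.lt_mul_div_succ k hd
  have hs : t < (t / T + 1) * T := by rw [mul_comm]; exact Nat.lt_mul_div_succ t hTpos
  have hbound := FP_le_and_FB_le_card (t := t)
    (fun x : Fin (k / d + 1) × Fin (t / T + 1) × (Fin d → F) =>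
      (blockColumn k hd x.1 x.2.2 : Fin k → F))
    (fun i => ⟨(⟨(i : ℕ) / d, Nat.lt_succ_of_le (Nat.div_le_div_right i.2.le)⟩, 0,
      Pi.single ⟨i % d, Nat.mod_lt _ hd⟩ 1), blockColumn_single hd i⟩)
    (exists_serving_columns hd hTpos hm.le hs.le (by omega))
  rw [Fintype.card_prod, Fintype.card_prod, Fintype.card_fin, Fintype.card_fin, ← hN] at hbound
  have hlen : ((k / d + 1) * ((t / T + 1) * N)) * d ≤ 16 * (k * t) :=
    length_mul_le hk ht (by omega)
  exact ⟨(Nat.mul_le_mul_right d hbound.1).trans hlen, (Nat.mul_le_mul_right d hbound.2).trans hlen⟩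

theorem tendsto_div_mul_zero {f : ℕ → ℕ → ℕ}
    (hf : ∀ d : ℕ, 0 < d → ∃ T : ℕ, ∀ k t : ℕ, d ≤ k → T ≤ t → f k t * d ≤ 16 * (k * t))
    {k t : ℕ → ℕ} (hk : Tendsto k atTop atTop) (ht : Tendsto t atTop atTop) :
    Tendsto (fun n => (f (k n) (t n) : ℝ) / ((k n : ℝ) * (t n : ℝ))) atTop (𝓝 0) := by
  rw [Metric.tendsto_atTop']
  intro ε hε
  obtain ⟨d, hd⟩ := exists_nat_gt (16 / ε)
  have hd0 : (0 : ℝ) < d := (by positivity : (0 : ℝ) < 16 / ε).trans hd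
  obtain ⟨T, hT⟩ := hf d (by exact_mod_cast hd0)
  obtain ⟨n₀, hn₀⟩ := eventually_atTop.1 <| (hk.eventually_ge_atTop (max d 1)).and
    (ht.eventually_ge_atTop (max T 1))
  refine ⟨n₀, fun n hn => ?_⟩
  obtain ⟨hkn, htn⟩ := hn₀ n hn.le
  have hkpos : (0 : ℝ) < k n := by exact_mod_cast (le_max_right d 1).trans hkn
  have htpos : (0 : ℝ) < t n := by exact_mod_cast (le_max_right T 1).trans htn
  have hle : (f (k n) (t n) : ℝ) * d ≤ 16 * ((k n : ℝ) * t n) := by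
    exact_mod_cast hT _ _ ((le_max_left d 1).trans hkn) ((le_max_left T 1).trans htn)
  rw [Real.dist_0_eq_abs, abs_of_nonneg (by positivity), div_lt_iff₀ (by positivity)]
  rw [div_lt_iff₀ hε] at hd
  have hpos : (0 : ℝ) < k n * t n := mul_pos hkpos htpos
  refine lt_of_mul_lt_mul_right ?_ hd0.le
  calc (f (k n) (t n) : ℝ) * d ≤ 16 * ((k n : ℝ) * t n) := hle
    _ < (d * ε) * ((k n : ℝ) * t n) := mul_lt_mul_of_pos_right hd hpos
    _ = ε * ((k n : ℝ) * t n) * d := by ring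

theorem mainTheorem12 (F : Type*) [Field F] [Finite F] (k t : ℕ → ℕ)
    (hk : Tendsto k atTop atTop) (ht : Tendsto t atTop atTop) :
    Tendsto (fun n => (FP F (k n) (t n) : ℝ) / ((k n : ℝ) * (t n : ℝ))) atTop (𝓝 0) ∧
    Tendsto (fun n => (FB F (k n) (t n) : ℝ) / ((k n : ℝ) * (t n : ℝ))) atTop (𝓝 0) := by
  refine ⟨tendsto_div_mul_zero (f := FP F) (fun d hd => ?_) hk ht,
    tendsto_div_mul_zero (f := FB F) (fun d hd => ?_) hk ht⟩
  · obtain ⟨T, hT⟩ := exists_FP_FB_mul_le F hd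
    exact ⟨T, fun k t hk ht => (hT k t hk ht).1⟩
  · obtain ⟨T, hT⟩ := exists_FP_FB_mul_le F hd
    exact ⟨T, fun k t hk ht => (hT k t hk ht).2⟩
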